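/- Let $\mathfrak H$ be a right quaternionic Hilbert space (right $\mathbb H$-module, complete, with inner product satisfying $\langle f\mid gq\rangle=\langle f\mid g\rangle q$, $\overline{\langle f\mid g\rangle}=\langle g\mid f\rangle$, $\langle f\mid f\rangle=\|f\|^2$) with a Hilbert basis $(e_n)_{n\ge 0}$, and let $q\cdot\phi=\sum_n e_n\,q\,\langle e_n\mid\phi\rangle$ ($q\in\mathbb H$, $\phi\in\mathfrak H$) be the left multiplication induced by this basis. On the dense subspace $\mathcal F$ of finite right-linear combinations of the $e_n$ let $$\mathsf a=\sum_{m}\sqrt{m+1}\,|e_m\rangle\langle e_{m+1}|,\quad \mathsf a^\dagger=\sum_m\sqrt{m+1}\,|e_{m+1}\rangle\langle e_m|,\quad Q=\tfrac1{\sqrt2}(\mathsf a+\mathsf a^\dagger),\quad P_0=-\tfrac1{\sqrt2}(\mathsf a-\mathsf a^\dagger),$$ and let $\hat{\mathfrak A}$ be the real linear span of the operators $\tau\cdot\mathbb I$, $\tau\cdot Q$ ($\tau=i,j,k$) and $P_0$ on $\mathcal F$. For an operator $\mathcal A$ on $\mathcal F$, let $e^{\mathcal A}$ be the operator whose graph is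 the closure in $\mathfrak H\times\mathfrak H$ of the graph of $\phi\mapsto\sum_{n\ge0}\frac1{n!}\mathcal A^n\phi$, defined on those $\phi\in\mathcal F$ for which the series converges. Then for every $\mathcal A\in\hat{\mathfrak A}$ the operator $U(\mathcal A)=e^{\mathcal A}$ is an everywhere defined, right-linear, unitary (i.e. $UU^\dagger=U^\dagger U=\mathbb I$) and continuous operator on $\mathfrak H$. Moreover $t\mapsto e^{t\mathcal A}$ ($t\in\mathbb R$) is a strongly continuous one-parameter group whose infinitesimal generator is the closure of $\mathcal A$. Furthermore $\mathcal A=\mathbf x\cdot\mathbb I+(q\cdot\mathsf a^\dagger-\bar q\cdot\mathsf a)$ for some $\mathbf x,q\in\mathbb H$ with $\operatorname{Re}\mathbf x=0$, and, with $D(q)=e^{q\cdot\mathsf a^\dagger-\bar q\cdot\mathsf a}$, the operator $\phi\mapsto e^{\mathbf x}\cdot(D(q)\phi)$ is also everywhere defined, right-linear, unitary and continuous; it equals $U(\mathcal A)$ whenever $\mathbf x q=q\mathbf x$. -/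

import Mathlib

noncomputable section

namespace QFock

/-- The quaternions with the opposite multiplication: a right quaternionic vector space is a
module over this ring, `φ q` being `MulOpposite.op q • φ`. -/
abbrev HOp : Type := (Quaternion ℝ)ᵐᵒᵖ

/-- Quaternion-valued inner product of a right quaternionic vector space, linear in the second
variable, and inducing the norm. Conjugate-linearity in the first variable follows. (A right
quaternionic Hilbert space is such a space that is also a `CompleteSpace`.) -/
class RightInner (H : Type*) [NormedAddCommGroup H] [Module HOp H] where
  qinner : H → H → Quaternion ℝ
  star_qinner : ∀ f g : H, star (qinner f g) = qinner g f
  qinner_self : ∀ f : H, qinner f f = ((‖f‖ ^ 2 : ℝ) : Quaternion ℝ)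
  qinner_add : ∀ f g h : H, qinner f (g + h) = qinner f g + qinner f h
  qinner_smul : ∀ (f g : H) (q : Quaternion ℝ),
    qinner f (MulOpposite.op q • g) = qinner f g * q

section Operators

variable {H : Type*} [NormedAddCommGroup H] [Module HOp H] [RightInner H]

/-- The inner product `⟨f | g⟩`. -/
def ip (f g : H) : Quaternion ℝ := RightInner.qinner f g

/-- `e` is an orthonormal (Hilbert) basis indexed by the natural numbers. -/
structure IsHilbertBasis (e : ℕ → H) : Prop where
  orthonormal : ∀ m n : ℕ, ip (e m) (e n) = if m = n then 1 else 0
  dense_span : Dense (Submodule.span HOp (Set.range e) : Set H)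

/-- Left multiplication of vectors by quaternions, induced by the basis `e`:
`q · φ = ∑ₖ eₖ q ⟨eₖ | φ⟩`. -/
def leftMul (e : ℕ → H) (q : Quaternion ℝ) (φ : H) : H :=
  ∑' k : ℕ, MulOpposite.op (q * ip (e k) φ) • e k

/-- The dense subspace of finite right-linear combinations of the basis vectors: the common
invariant domain of the creation and annihilation operators and of the left multiplications. -/
abbrev Fin₀ (e : ℕ → H) : Submodule HOp H := Submodule.span HOp (Set.range e)

/-- The basis vectors, as elements of the subspace that they span. -/
def vec (e : ℕ → H) (n : ℕ) : Fin₀ e := ⟨e n, Submodule.subset_span ⟨n, rfl⟩⟩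

theorem finite_support_ip {e : ℕ → H} (he : IsHilbertBasis e) (φ : Fin₀ e) :
    (Function.support fun k => ip (e k) (φ : H)).Finite := by
  obtain ⟨φ, hφ⟩ := φ
  induction hφ using Submodule.span_induction with
  | mem x hx =>
    obtain ⟨n, rfl⟩ := hx
    refine (Set.finite_singleton n).subset fun k hk => ?_
    by_contra hkn
    exact hk (by simpa [he.orthonormal] using fun h => hkn h)
  | zero =>
    have h0 : ∀ f : H, ip f (0 : H) = 0 := fun f => by
      have := RightInner.qinner_add f 0 0
      simpa [ip] using this
    simp [h0]
  | add x y _ _ hx hy =>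
    refine (hx.union hy).subset fun k hk => ?_
    by_contra hn
    simp only [Set.mem_union, Function.mem_support, not_or, not_not] at hn
    exact hk (by
      have := RightInner.qinner_add (e k) x y
      simp only [ip] at hn ⊢
      rw [this, hn.1, hn.2, add_zero])
  | smul c x _ hx =>
    refine hx.subset fun k hk => ?_
    by_contra hn
    simp only [Function.mem_support, not_not] at hn
    exact hk (by
      have := RightInner.qinner_smul (e k) x c.unop
      simp only [ip, MulOpposite.op_unop] at hn this ⊢
      rw [this, hn, zero_mul])

/-- The operator `∑ₖ |e_{s k}⟩ w k ⟨e_{t k}|` on finite combinations of the basis vectors. -/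
def ketBra {e : ℕ → H} (he : IsHilbertBasis e) (s : ℕ → ℕ) (w : ℕ → Quaternion ℝ)
    (t : ℕ → ℕ) (ht : Function.Injective t) : Module.End HOp (Fin₀ e) :=
  have hfin : ∀ φ : Fin₀ e, (Function.support fun k =>
      MulOpposite.op (w k * ip (e (t k)) (φ : H)) • vec e (s k)).Finite := fun φ => by
    refine ((finite_support_ip he φ).preimage ht.injOn).subset fun k hk => ?_
    rw [Set.mem_preimage, Function.mem_support]
    intro h0
    exact hk (by simp only [h0, mul_zero, MulOpposite.op_zero, zero_smul])
  { toFun := fun φ => ∑ᶠ k : ℕ, MulOpposite.op (w k * ip (e (t k)) (φ : H)) • vec e (s k)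
    map_add' := fun φ ψ => by
      rw [← finsum_add_distrib (hfin φ) (hfin ψ)]
      refine finsum_congr fun k => ?_
      have := RightInner.qinner_add (e (t k)) (φ : H) ψ
      simp only [ip, Submodule.coe_add]
      rw [this, mul_add, MulOpposite.op_add, add_smul]
    map_smul' := fun c φ => by
      rw [RingHom.id_apply, smul_finsum' _ (hfin φ)]
      refine finsum_congr fun k => ?_
      have := RightInner.qinner_smul (e (t k)) (φ : H) c.unop
      simp only [MulOpposite.op_unop] at this
      simp only [ip, Submodule.coe_smul]
      rw [this, ← mul_assoc, MulOpposite.op_mul, MulOpposite.op_unop, mul_smul] }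

/-- `q · 𝕀`: left multiplication by `q`. -/
def leftOp {e : ℕ → H} (he : IsHilbertBasis e) (q : Quaternion ℝ) : Module.End HOp (Fin₀ e) :=
  ketBra he id (fun _ => q) id Function.injective_id

/-- The annihilation operator `∑ₘ √(m+1) |eₘ⟩⟨eₘ₊₁|`. -/
def annih {e : ℕ → H} (he : IsHilbertBasis e) : Module.End HOp (Fin₀ e) :=
  ketBra he id (fun m => ((√((m : ℝ) + 1) : ℝ) : Quaternion ℝ)) Nat.succ Nat.succ_injective

/-- The creation operator `∑ₘ √(m+1) |eₘ₊₁⟩⟨eₘ|`. -/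
def creat {e : ℕ → H} (he : IsHilbertBasis e) : Module.End HOp (Fin₀ e) :=
  ketBra he Nat.succ (fun m => ((√((m : ℝ) + 1) : ℝ) : Quaternion ℝ)) id Function.injective_id

/-- On finite combinations of basis vectors `leftOp` is the left multiplication of vectors. -/
theorem coe_leftOp {e : ℕ → H} (he : IsHilbertBasis e) (q : Quaternion ℝ) (φ : Fin₀ e) :
    ((leftOp he q φ : Fin₀ e) : H) = leftMul e q φ := by
  have hs : (Function.support fun k =>
      MulOpposite.op (q * ip (e k) (φ : H)) • e k) ⊆
      Function.support fun k => ip (e k) (φ : H) := fun k hk => by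
    rw [Function.mem_support]
    intro h0
    exact hk (by simp only [h0, mul_zero, MulOpposite.op_zero, zero_smul])
  have hs' : (Function.support fun k =>
      MulOpposite.op (q * ip (e k) (φ : H)) • vec e k) ⊆
      Function.support fun k => ip (e k) (φ : H) := fun k hk => by
    rw [Function.mem_support]
    intro h0
    exact hk (by simp only [h0, mul_zero, MulOpposite.op_zero, zero_smul])
  have hf := finite_support_ip he φ
  unfold leftMul
  rw [tsum_eq_finsum (hf.subset hs)]
  have h1 : leftOp he q φ =
      ∑ᶠ k : ℕ, MulOpposite.op (q * ip (e k) (φ : H)) • vec e k := rfl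
  rw [h1, finsum_eq_sum_of_support_subset (s := hf.toFinset) _ (by simpa using hs'),
    finsum_eq_sum_of_support_subset (s := hf.toFinset) _ (by simpa using hs)]
  simp [vec]

/-- A right-linear operator on the whole space is unitary: it has an adjoint, which is its
two-sided inverse. -/
def IsUnitary (U : Module.End HOp H) : Prop :=
  ∃ V : Module.End HOp H,
    (∀ φ ψ : H, ip (U φ) ψ = ip φ (V ψ)) ∧ U * V = 1 ∧ V * U = 1

variable [NormedSpace ℝ H] [IsScalarTower ℝ HOp H]

/-- The position operator `Q = (a + a†) / √2`. -/
def posOp {e : ℕ → H} (he : IsHilbertBasis e) : Module.End HOp (Fin₀ e) :=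
  (1 / √2 : ℝ) • (annih he + creat he)

/-- The operator `P₀ = -(a - a†) / √2`. -/
def momOp {e : ℕ → H} (he : IsHilbertBasis e) : Module.End HOp (Fin₀ e) :=
  -((1 / √2 : ℝ) • (annih he - creat he))

/-- The quaternionic imaginary units `i`, `j`, `k`. -/
def imagUnit : Fin 3 → Quaternion ℝ := ![⟨0, 1, 0, 0⟩, ⟨0, 0, 1, 0⟩, ⟨0, 0, 0, 1⟩]

/-- The quaternionic Weyl–Heisenberg Lie algebra: the real linear span of `τ · 𝕀`, `τ · Q`
(`τ = i, j, k`) and `P₀`. -/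
def weylHeisenberg {e : ℕ → H} (he : IsHilbertBasis e) :
    Submodule ℝ (Module.End HOp (Fin₀ e)) :=
  Submodule.span ℝ
    (Set.range (fun τ : Fin 3 => leftOp he (imagUnit τ)) ∪
      Set.range (fun τ : Fin 3 => leftOp he (imagUnit τ) * posOp he) ∪ {momOp he})

/-- `q · a† - q̄ · a`. -/
def dispGen {e : ℕ → H} (he : IsHilbertBasis e) (q : Quaternion ℝ) : Module.End HOp (Fin₀ e) :=
  leftOp he q * creat he - leftOp he (star q) * annih he

/-- The graph of the operator `A`. -/
def opGraph {e : ℕ → H} (A : Module.End HOp (Fin₀ e)) : Set (H × H) :=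
  Set.range fun φ : Fin₀ e => ((φ : H), ((A φ : Fin₀ e) : H))

/-- `U = e^A`: the graph of `U` is the closure of the graph of the exponential series
`φ ↦ ∑ₙ Aⁿ φ / n!`, taken on those `φ` in the domain of `A` for which it converges. -/
def IsExp {e : ℕ → H} (A : Module.End HOp (Fin₀ e)) (U : Module.End HOp H) : Prop :=
  {p : H × H | U p.1 = p.2} =
    closure {p : H × H | ∃ φ : Fin₀ e, (φ : H) = p.1 ∧
      HasSum (fun n : ℕ => ((Nat.factorial n : ℝ)⁻¹) • (((A ^ n) φ : Fin₀ e) : H)) p.2}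

/-- `U` is a strongly continuous one-parameter group of operators, and its infinitesimal
generator (the derivative at `t = 0`, on the vectors where it exists) is the closure of `A`. -/
structure IsGroupGeneratedBy {e : ℕ → H} (A : Module.End HOp (Fin₀ e))
    (U : ℝ → Module.End HOp H) : Prop where
  zero : U 0 = 1
  add : ∀ s t : ℝ, U (s + t) = U s * U t
  strongly_continuous : ∀ φ : H, Continuous fun t => U t φ
  generator : {p : H × H | HasDerivAt (fun t : ℝ => U t p.1) p.2 0} = closure (opGraph A)

end Operators

end QFock

end

/-! ### Skew operators with entire vectors on a real Hilbert space: the unitary group and its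
generator. -/

noncomputable section EntireSkew

open Filter Topology

open scoped RealInnerProductSpace

/-! Every element of the algebra has the form `leftOp he x + dispGen he q` with `x` imaginary. Since
`creat` and `annih` are mutually adjoint and commute with left multiplications, such an operator `A`
is skew for the quaternionic inner product (`ip_weylHeisenberg`). It sends `e m` to a combination of
its neighbours with coefficients of order `√(m+1)`, so `‖Aⁿ e m‖ ≤ Cⁿ √((m+1)⋯(m+n))`
(`norm_pow_vec_le`). Division by `n!` beats this growth, so the exponential series converges on all
of `Fin₀ e` for every real `t`.

The analysis needs only the real inner product `Re ⟨f | g⟩`. There skewness makes inner products of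
two exponential series invariant under a common time shift (`inner_series_add`). Isometry, the
adjoint and the group law all follow from this on a dense domain, and then everywhere. The domain
need not be invariant under the group, so the generator is found from the integrals `∫₀ᵗ U(s) f ds`,
which lie in the domain of the closure of `A`. Right-linearity and the quaternionic adjoint are
recovered afterwards by density and by testing against all multiples `g q`.

If `x` and `q` commute, so do `leftOp he x` and `dispGen he q`, and the Cauchy product of the two
exponential series factors `U` (`hasSum_pow_add`). -/

/-- A densely defined skew-symmetric operator `A` on a real Hilbert space, the domain `F` being
invariant and consisting of vectors `φ` such that `∑ tⁿ ‖Aⁿ φ‖ / n!` converges for all `t`. -/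
structure IsEntireSkew {E F : Type*} [NormedAddCommGroup E] [InnerProductSpace ℝ E]
    [AddCommGroup F] [Module ℝ F] (ι : F →ₗ[ℝ] E) (A : Module.End ℝ F) : Prop where
  dense : DenseRange ι
  skew : ∀ φ ψ : F, ⟪ι (A φ), ι ψ⟫ = -⟪ι φ, ι (A ψ)⟫
  entire : ∀ (t : ℝ) (φ : F), Summable fun n : ℕ => |t| ^ n / n.factorial * ‖ι ((A ^ n) φ)‖

namespace IsEntireSkew

variable {E F : Type*} [NormedAddCommGroup E] [InnerProductSpace ℝ E] [CompleteSpace E]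
  [AddCommGroup F] [Module ℝ F] {ι : F →ₗ[ℝ] E} {A : Module.End ℝ F}

theorem summable (h : IsEntireSkew ι A) (t : ℝ) (φ : F) :
    Summable fun n : ℕ => (t ^ n / n.factorial) • ι ((A ^ n) φ) := by
  refine Summable.of_norm ((h.entire t φ).congr fun n => ?_)
  rw [norm_smul, Real.norm_eq_abs, abs_div, abs_pow, Nat.abs_cast]

/-- The exponential series `φ ↦ ∑ tⁿ Aⁿ φ / n!` on the domain of `A`. -/
def series (h : IsEntireSkew ι A) (t : ℝ) : F →ₗ[ℝ] E where
  toFun φ := ∑' n : ℕ, (t ^ n / n.factorial) • ι ((A ^ n) φ)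
  map_add' φ ψ := by
    rw [← (h.summable t φ).tsum_add (h.summable t ψ)]
    simp only [map_add, smul_add]
  map_smul' c φ := by
    rw [RingHom.id_apply, ← (h.summable t φ).tsum_const_smul c]
    simp only [map_smul, smul_comm c]

theorem hasSum_series (h : IsEntireSkew ι A) (t : ℝ) (φ : F) :
    HasSum (fun n : ℕ => (t ^ n / n.factorial) • ι ((A ^ n) φ)) (h.series t φ) :=
  (h.summable t φ).hasSum

theorem series_zero (h : IsEntireSkew ι A) (φ : F) : h.series 0 φ = ι φ := by
  refine (h.hasSum_series 0 φ).unique ?_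
  convert hasSum_single (f := fun n : ℕ => ((0 : ℝ) ^ n / n.factorial) • ι ((A ^ n) φ)) 0 ?_ using 1
  · simp
  · intro n hn
    simp [hn]

theorem hasDerivAt_series (h : IsEntireSkew ι A) (t : ℝ) (φ : F) :
    HasDerivAt (fun s => h.series s φ) (h.series t (A φ)) t := by
  have hder : HasDerivAt (fun s : ℝ => ∑' n : ℕ, (s ^ n / n.factorial) • ι ((A ^ n) φ))
      (∑' n : ℕ, ((n : ℝ) * t ^ (n - 1) / n.factorial) • ι ((A ^ n) φ)) t := by
    -- The majorant `u` bounds the differentiated terms on the ball of radius `|t| + 1`. Its term at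
    -- `n = 0` vanishes, and shifted by one it is the `entire` series of `A φ` at `|t| + 1`.
    refine hasDerivAt_tsum_of_isPreconnected
      (u := fun n : ℕ => (n : ℝ) * (|t| + 1) ^ (n - 1) / n.factorial * ‖ι ((A ^ n) φ)‖)
      (g := fun (n : ℕ) (s : ℝ) => (s ^ n / n.factorial) • ι ((A ^ n) φ))
      (g' := fun (n : ℕ) (s : ℝ) => ((n : ℝ) * s ^ (n - 1) / n.factorial) • ι ((A ^ n) φ))
      (t := Metric.ball (0 : ℝ) (|t| + 1)) (y₀ := t) ?_ Metric.isOpen_ball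
      (convex_ball _ _).isPreconnected ?_ ?_ ?_ (h.summable t φ) ?_
    · rw [← summable_nat_add_iff 1]
      refine (h.entire (|t| + 1) (A φ)).congr fun n => ?_
      rw [abs_of_nonneg (by positivity : (0 : ℝ) ≤ |t| + 1), ← Module.End.mul_apply, ← pow_succ,
        Nat.factorial_succ, Nat.add_sub_cancel]
      push_cast
      field_simp
    · intro n s _
      exact ((hasDerivAt_pow n s).div_const _).smul_const _
    · intro n s hs
      rw [mem_ball_zero_iff, Real.norm_eq_abs] at hs
      rw [norm_smul, Real.norm_eq_abs, abs_div, abs_mul, abs_pow, Nat.abs_cast, Nat.abs_cast]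
      gcongr
    · simp
    · simp
  refine hder.congr_deriv (Eq.symm ?_)
  change ∑' n : ℕ, (t ^ n / n.factorial) • ι ((A ^ n) (A φ)) = _
  rw [eq_comm, Summable.tsum_eq_zero_add]
  · simp only [CharP.cast_eq_zero, zero_mul, zero_div, zero_smul, zero_add]
    refine tsum_congr fun n => ?_
    rw [← Module.End.mul_apply, ← pow_succ, Nat.factorial_succ, Nat.add_sub_cancel]
    congr 1
    push_cast
    field_simp
  · rw [← summable_nat_add_iff 1]
    refine (h.summable t (A φ)).congr fun n => ?_
    rw [← Module.End.mul_apply, ← pow_succ, Nat.factorial_succ, Nat.add_sub_cancel]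
    congr 1
    push_cast
    field_simp

theorem tendsto_partialSum (h : IsEntireSkew ι A) (t : ℝ) (φ : F) :
    Tendsto (fun N : ℕ => ι (∑ n ∈ Finset.range N, (t ^ n / n.factorial) • (A ^ n) φ)) atTop
      (𝓝 (h.series t φ)) := by
  simpa only [map_sum, map_smul] using (h.hasSum_series t φ).tendsto_sum_nat

theorem tendsto_map_partialSum (h : IsEntireSkew ι A) (t : ℝ) (φ : F) :
    Tendsto (fun N : ℕ => ι (A (∑ n ∈ Finset.range N, (t ^ n / n.factorial) • (A ^ n) φ))) atTop
      (𝓝 (h.series t (A φ))) := by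
  refine (h.tendsto_partialSum t (A φ)).congr fun N => ?_
  simp only [map_sum, map_smul, ← Module.End.mul_apply, ← pow_succ, ← pow_succ']

/-- The sums need not lie in the domain, so skewness is applied to partial sums and passed to the
limit. -/
theorem skew_series (h : IsEntireSkew ι A) (s t : ℝ) (φ ψ : F) :
    ⟪h.series s (A φ), h.series t ψ⟫ = -⟪h.series s φ, h.series t (A ψ)⟫ := by
  refine tendsto_nhds_unique ((h.tendsto_map_partialSum s φ).inner (𝕜 := ℝ)
    (h.tendsto_partialSum t ψ)) ?_
  simp only [h.skew]
  exact ((h.tendsto_partialSum s φ).inner (h.tendsto_map_partialSum t ψ)).neg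

/-- By `skew_series` the derivative in `s` vanishes. Isometry is the case `a = b = 0`, the adjoint
relation the case `(0, -t)`, the group law the case `(0, t)`. -/
theorem inner_series_add (h : IsEntireSkew ι A) (s a b : ℝ) (φ ψ : F) :
    ⟪h.series (s + a) φ, h.series (s + b) ψ⟫ = ⟪h.series a φ, h.series b ψ⟫ := by
  have hder : ∀ r : ℝ, HasDerivAt (fun r => ⟪h.series (r + a) φ, h.series (r + b) ψ⟫) 0 r := by
    intro r
    have h1 := (h.hasDerivAt_series (r + a) φ).comp_add_const r a
    have h2 := (h.hasDerivAt_series (r + b) ψ).comp_add_const r b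
    exact (h1.inner ℝ h2).congr_deriv (by rw [h.skew_series, add_neg_cancel])
  have := is_const_of_deriv_eq_zero (fun r => (hder r).differentiableAt)
    (fun r => (hder r).deriv) s 0
  simpa using this

theorem norm_series (h : IsEntireSkew ι A) (t : ℝ) (φ : F) : ‖h.series t φ‖ = ‖ι φ‖ := by
  have := h.inner_series_add t 0 0 φ φ
  rw [add_zero, series_zero, real_inner_self_eq_norm_sq, real_inner_self_eq_norm_sq] at this
  exact (sq_eq_sq₀ (norm_nonneg _) (norm_nonneg _)).1 this

/-- The unitary group generated by `A`: the continuous extension of the exponential series. -/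
def group (h : IsEntireSkew ι A) (t : ℝ) : E →L[ℝ] E := (h.series t).extendOfNorm ι

theorem group_apply (h : IsEntireSkew ι A) (t : ℝ) (φ : F) :
    h.group t (ι φ) = h.series t φ :=
  LinearMap.extendOfNorm_eq h.dense ⟨1, fun φ => by rw [norm_series, one_mul]⟩ φ

theorem norm_group (h : IsEntireSkew ι A) (t : ℝ) (f : E) : ‖h.group t f‖ = ‖f‖ :=
  h.dense.induction_on (p := fun f => ‖h.group t f‖ = ‖f‖) f
    (isClosed_eq (by fun_prop) (by fun_prop)) fun φ => by rw [group_apply, norm_series]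

theorem group_zero (h : IsEntireSkew ι A) (f : E) : h.group 0 f = f :=
  h.dense.induction_on (p := fun f => h.group 0 f = f) f
    (isClosed_eq (by fun_prop) (by fun_prop)) fun φ => by rw [group_apply, series_zero]

theorem inner_group_left (h : IsEntireSkew ι A) (t : ℝ) (f g : E) :
    ⟪h.group t f, g⟫ = ⟪f, h.group (-t) g⟫ :=
  h.dense.induction_on₂ (p := fun f g => ⟪h.group t f, g⟫ = ⟪f, h.group (-t) g⟫)
    (isClosed_eq (by fun_prop) (by fun_prop)) (fun φ ψ => by
      have := h.inner_series_add t 0 (-t) φ ψ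
      rwa [add_zero, add_neg_cancel, series_zero, series_zero, ← group_apply, ← group_apply]
        at this) f g

theorem inner_group_group (h : IsEntireSkew ι A) (t : ℝ) (f g : E) :
    ⟪h.group t f, h.group t g⟫ = ⟪f, g⟫ :=
  (LinearMap.norm_map_iff_inner_map_map (h.group t)).1 (h.norm_group t) f g

theorem group_neg_group (h : IsEntireSkew ι A) (t : ℝ) (f : E) :
    h.group (-t) (h.group t f) = f :=
  ext_inner_left ℝ fun g => by rw [← inner_group_left, inner_group_group]

theorem group_group_neg (h : IsEntireSkew ι A) (t : ℝ) (f : E) :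
    h.group t (h.group (-t) f) = f := by
  simpa using h.group_neg_group (-t) f

theorem group_add (h : IsEntireSkew ι A) (s t : ℝ) (f : E) :
    h.group (s + t) f = h.group s (h.group t f) := by
  rw [← h.group_group_neg s (h.group (s + t) f)]
  congr 1
  refine ext_inner_left ℝ fun g => ?_
  rw [← inner_group_left]
  refine h.dense.induction_on₂
    (p := fun g f => ⟪h.group s g, h.group (s + t) f⟫ = ⟪g, h.group t f⟫)
    (isClosed_eq (by fun_prop) (by fun_prop)) (fun φ ψ => ?_) g f
  have := h.inner_series_add s 0 t φ ψ
  rwa [add_zero, series_zero, ← group_apply, ← group_apply, ← group_apply] at this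

theorem continuous_group (h : IsEntireSkew ι A) (f : E) : Continuous fun t => h.group t f := by
  refine continuous_iff_continuousAt.2 fun t => Metric.continuousAt_iff'.2 fun ε hε => ?_
  obtain ⟨φ, hφ⟩ := h.dense.exists_dist_lt f (by positivity : 0 < ε / 3)
  have hc : ContinuousAt (fun s => h.group s (ι φ)) t := by
    simpa only [group_apply] using (h.hasDerivAt_series t φ).continuousAt
  have hd : ∀ s, dist (h.group s f) (h.group s (ι φ)) < ε / 3 := fun s => by
    rwa [dist_eq_norm, ← map_sub, norm_group, ← dist_eq_norm]
  filter_upwards [Metric.continuousAt_iff'.1 hc (ε / 3) (by positivity)] with s hs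
  calc dist (h.group s f) (h.group t f)
      ≤ dist (h.group s f) (h.group s (ι φ)) + dist (h.group s (ι φ)) (h.group t (ι φ))
        + dist (h.group t (ι φ)) (h.group t f) := dist_triangle4 _ _ _ _
    _ < ε / 3 + ε / 3 + ε / 3 := by
        gcongr
        · exact hd s
        · exact dist_comm (h.group t f) _ ▸ hd t
    _ = ε := by ring

/-- The integrated group `f ↦ ∫₀ᵗ U(s) f ds`. -/
def integratedGroup (h : IsEntireSkew ι A) (t : ℝ) : E →L[ℝ] E :=
  LinearMap.mkContinuous
    { toFun := fun f => ∫ s in (0 : ℝ)..t, h.group s f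
      map_add' := fun f g => by
        simp only [map_add]
        exact intervalIntegral.integral_add ((h.continuous_group f).intervalIntegrable _ _)
          ((h.continuous_group g).intervalIntegrable _ _)
      map_smul' := fun c f => by
        simp only [map_smul, RingHom.id_apply]
        exact intervalIntegral.integral_smul c _ }
    |t| fun f => by
      have := intervalIntegral.norm_integral_le_of_norm_le_const (a := (0 : ℝ)) (b := t)
        (f := fun s => h.group s f) (C := ‖f‖) fun s _ => (h.norm_group s f).le
      simpa [mul_comm] using this

theorem integratedGroup_apply (h : IsEntireSkew ι A) (t : ℝ) (f : E) :
    h.integratedGroup t f = ∫ s in (0 : ℝ)..t, h.group s f := rfl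

theorem hasDerivAt_integratedGroup (h : IsEntireSkew ι A) (f : E) :
    HasDerivAt (fun t => h.integratedGroup t f) f 0 := by
  have := intervalIntegral.integral_hasDerivAt_right
    ((h.continuous_group f).intervalIntegrable 0 0)
    ((h.continuous_group f).stronglyMeasurableAtFilter _ _) (h.continuous_group f).continuousAt
  rwa [group_zero] at this

/-- The fundamental theorem of calculus. Only bounded operators act on `ι φ` and `ι (A φ)` here, so
the relation survives closure of the graph. -/
theorem integratedGroup_map (h : IsEntireSkew ι A) (t : ℝ) (φ : F) :
    h.integratedGroup t (ι (A φ)) = h.group t (ι φ) - ι φ := by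
  have := intervalIntegral.integral_eq_sub_of_hasDerivAt (a := 0) (b := t)
    (fun s _ => h.hasDerivAt_series s φ)
    ((by simpa only [group_apply] using (h.continuous_group (ι (A φ)))
      : Continuous fun s => h.series s (A φ)).intervalIntegrable _ _)
  simpa only [← group_apply, group_zero, integratedGroup_apply] using this

/-- For `f = ι φ` the pair is the integral of a curve in the closed graph, which is a closed
subspace. Density gives the other `f`. -/
theorem mem_closure_integratedGroup (h : IsEntireSkew ι A) (t : ℝ) (f : E) :
    (h.integratedGroup t f, h.group t f - f) ∈
      ((LinearMap.range (ι.prod (ι ∘ₗ A))).topologicalClosure : Set (E × E)) := by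
  refine h.dense.induction_on (p := fun f => (h.integratedGroup t f, h.group t f - f) ∈
    ((LinearMap.range (ι.prod (ι ∘ₗ A))).topologicalClosure : Set (E × E))) f
    ((Submodule.isClosed_topologicalClosure _).preimage (by fun_prop)) fun φ => ?_
  have hc : ∀ ψ, Continuous fun s => h.series s ψ := fun ψ => by
    simpa only [group_apply] using h.continuous_group (ι ψ)
  set G := (LinearMap.range (ι.prod (ι ∘ₗ A))).topologicalClosure
  have : CompleteSpace G := (Submodule.isClosed_topologicalClosure _).completeSpace_coe
  have hmem : ∀ s, (h.series s φ, h.series s (A φ)) ∈ G := fun s =>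
    mem_closure_of_tendsto
      ((h.tendsto_partialSum s φ).prodMk_nhds (h.tendsto_map_partialSum s φ))
      (Eventually.of_forall fun N => ⟨_, rfl⟩)
  -- Integrating inside `G` makes membership automatic; `h1` and `h2` identify the two components.
  let c : ℝ → G := fun s => ⟨_, hmem s⟩
  have hci : IntervalIntegrable c MeasureTheory.volume 0 t :=
    (((hc φ).prodMk (hc (A φ))).subtype_mk hmem).intervalIntegrable _ _
  have h1 := ((ContinuousLinearMap.fst ℝ E E).comp G.subtypeL).intervalIntegral_comp_comm hci
  have h2 := ((ContinuousLinearMap.snd ℝ E E).comp G.subtypeL).intervalIntegral_comp_comm hci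
  rw [← integratedGroup_map]
  simp only [integratedGroup_apply, group_apply]
  have h3 : ((∫ s in (0 : ℝ)..t, c s : G) : E × E) =
      (∫ s in (0 : ℝ)..t, h.series s φ, ∫ s in (0 : ℝ)..t, h.series s (A φ)) :=
    Prod.ext h1.symm h2.symm
  exact h3 ▸ (∫ s in (0 : ℝ)..t, c s).2

theorem generator (h : IsEntireSkew ι A) :
    {p : E × E | HasDerivAt (fun t : ℝ => h.group t p.1) p.2 0} =
      closure (Set.range fun φ : F => (ι φ, ι (A φ))) := by
  have hcoe : (Set.range fun φ : F => (ι φ, ι (A φ))) =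
      (LinearMap.range (ι.prod (ι ∘ₗ A)) : Set (E × E)) := by
    ext; simp
  apply Set.Subset.antisymm
  -- The pair `(f, g)` is the limit of `t⁻¹ (∫₀ᵗ U(s) f ds, U(t) f - f)`, which stays in the closed
  -- graph.
  · rintro ⟨f, g⟩ hfg
    simp only [Set.mem_ofPred_eq] at hfg
    rw [hcoe]
    have h1 := hasDerivAt_iff_tendsto_slope.1 (h.hasDerivAt_integratedGroup f)
    have h2 := hasDerivAt_iff_tendsto_slope.1 hfg
    refine (Submodule.isClosed_topologicalClosure _).mem_of_tendsto (h1.prodMk_nhds h2)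
      (Eventually.of_forall fun t => ?_)
    have h3 := Submodule.smul_mem _ t⁻¹ (h.mem_closure_integratedGroup t f)
    simpa only [SetLike.mem_coe, slope, group_zero, integratedGroup_apply,
      intervalIntegral.integral_same, sub_zero, vsub_eq_sub, Prod.smul_mk] using h3
  -- The integrated equation cuts out a closed set containing the graph; differentiating it at `0`
  -- returns the derivative condition.
  · refine (closure_minimal (t := {p : E × E | ∀ t, h.integratedGroup t p.2 = h.group t p.1 - p.1})
      ?_ ?_).trans fun p hp => ?_
    · rintro _ ⟨φ, rfl⟩ t
      exact h.integratedGroup_map t φ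
    · simp only [Set.ofPred_forall]
      exact isClosed_iInter fun t => isClosed_eq (by fun_prop) (by fun_prop)
    · simp only [Set.mem_ofPred_eq] at hp
      simpa [hp] using (h.hasDerivAt_integratedGroup p.2).add_const p.1

end IsEntireSkew

end EntireSkew

noncomputable section

namespace QFock

open MulOpposite

/-! ### Quaternionic inner products and the underlying real structure. -/

section InnerProduct

variable {H : Type*} [NormedAddCommGroup H] [Module HOp H] [RightInner H]

theorem ip_add_right (f g h : H) : ip f (g + h) = ip f g + ip f h := RightInner.qinner_add f g h

theorem ip_smul_right (f g : H) (c : HOp) : ip f (c • g) = ip f g * c.unop :=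
  RightInner.qinner_smul f g c.unop

theorem star_ip (f g : H) : star (ip f g) = ip g f := RightInner.star_qinner f g

theorem ip_add_left (f g h : H) : ip (f + g) h = ip f h + ip g h := by
  rw [← star_ip, ip_add_right, star_add, star_ip, star_ip]

theorem ip_smul_left (f g : H) (c : HOp) : ip (c • f) g = star c.unop * ip f g := by
  rw [← star_ip, ip_smul_right, star_mul, star_ip]

theorem ip_self (f : H) : ip f f = ((‖f‖ ^ 2 : ℝ) : Quaternion ℝ) := RightInner.qinner_self f

@[simp]
theorem ip_zero_right (f : H) : ip f 0 = 0 := by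
  simpa using ip_smul_right f 0 0

@[simp]
theorem ip_zero_left (f : H) : ip 0 f = 0 := by
  rw [← star_ip, ip_zero_right, star_zero]

theorem ip_neg_right (f g : H) : ip f (-g) = -ip f g :=
  map_neg (AddMonoidHom.mk' (ip f) (ip_add_right f)) g

theorem ip_sub_right (f g h : H) : ip f (g - h) = ip f g - ip f h :=
  map_sub (AddMonoidHom.mk' (ip f) (ip_add_right f)) g h

theorem ip_sub_left (f g h : H) : ip (f - g) h = ip f h - ip g h := by
  rw [← star_ip, ip_sub_right, star_sub, star_ip, star_ip]

theorem ip_sum_right {ι : Type*} (s : Finset ι) (f : H) (g : ι → H) :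
    ip f (∑ i ∈ s, g i) = ∑ i ∈ s, ip f (g i) :=
  map_sum (AddMonoidHom.mk' (ip f) (ip_add_right f)) g s

theorem norm_smul_hop (c : HOp) (f : H) : ‖c • f‖ = ‖c.unop‖ * ‖f‖ := by
  have h : ip (c • f) (c • f) = ((‖c.unop‖ * ‖f‖) ^ 2 : ℝ) := by
    rw [ip_smul_left, ip_smul_right, ip_self, Quaternion.coe_commutes, ← mul_assoc,
      Quaternion.star_mul_self, Quaternion.normSq_eq_norm_mul_self, ← Quaternion.coe_mul]
    congr 1
    ring
  rw [ip_self, Quaternion.coe_inj] at h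
  exact (sq_eq_sq₀ (norm_nonneg _) (by positivity)).1 h

theorem continuous_smul_hop (c : HOp) : Continuous fun f : H => c • f := by
  refine AddMonoidHomClass.continuous_of_bound (DistribSMul.toAddMonoidHom H c) ‖c.unop‖ ?_
  exact fun f => (norm_smul_hop c f).le

theorem quaternion_ext_re_mul {z w : Quaternion ℝ} (h : ∀ q, (z * q).re = (w * q).re) : z = w := by
  -- With this `q`, the product `(z - w) q` is the real number `normSq (z - w)`.
  have h1 := h (star (z - w))
  rw [← sub_eq_zero, ← Quaternion.re_sub, ← sub_mul, Quaternion.self_mul_star,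
    Quaternion.re_coe, Quaternion.normSq_eq_zero] at h1
  exact sub_eq_zero.1 h1

/-- A real adjointness relation between right-linear operators is a quaternionic one. -/
theorem ip_eq_of_re {U V : Module.End HOp H}
    (h : ∀ f g : H, (ip (U f) g).re = (ip f (V g)).re) (f g : H) : ip (U f) g = ip f (V g) := by
  refine quaternion_ext_re_mul fun q => ?_
  have := h f (op q • g)
  rwa [map_smul, ip_smul_right, ip_smul_right] at this

end InnerProduct

section Real

variable {H : Type*} [NormedAddCommGroup H] [NormedSpace ℝ H] [Module HOp H]
  [IsScalarTower ℝ HOp H]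

theorem real_smul_eq (r : ℝ) (f : H) : r • f = op (r : Quaternion ℝ) • f := by
  rw [← one_smul HOp f, ← smul_assoc, one_smul]
  congr 1
  apply unop_injective
  rw [unop_smul, unop_one, unop_op, ← Quaternion.coe_one, Quaternion.smul_coe, mul_one]

/-- The real inner product `Re ⟨f | g⟩`. -/
@[reducible]
def realInnerProductSpace [RightInner H] : InnerProductSpace ℝ H where
  inner f g := (ip f g).re
  norm_sq_eq_re_inner f := by rw [ip_self, Quaternion.re_coe]; rfl
  conj_inner_symm f g := by rw [← star_ip f g]; simp
  add_left f g h := by rw [ip_add_left, Quaternion.re_add]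
  smul_left f g r := by
    rw [real_smul_eq, ip_smul_left]
    simp

end Real

/-! ### Ladder operators and left multiplications on the finite combinations. -/

section Span

variable {H : Type*} [NormedAddCommGroup H] [Module HOp H] {e : ℕ → H}

@[simp]
theorem coe_vec (n : ℕ) : (vec e n : H) = e n := rfl

theorem fin₀_induction {p : Fin₀ e → Prop} (hvec : ∀ n, p (vec e n)) (hzero : p 0)
    (hadd : ∀ φ ψ, p φ → p ψ → p (φ + ψ)) (hsmul : ∀ (c : HOp) φ, p φ → p (c • φ))
    (φ : Fin₀ e) : p φ := by
  obtain ⟨φ, hφ⟩ := φ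
  induction hφ using Submodule.span_induction with
  | mem x hx =>
    obtain ⟨n, rfl⟩ := hx
    exact hvec n
  | zero => exact hzero
  | add x y _ _ hx hy => exact hadd _ _ hx hy
  | smul c x _ hx => exact hsmul c _ hx

theorem end_ext {S T : Module.End HOp (Fin₀ e)} (h : ∀ n, S (vec e n) = T (vec e n)) : S = T := by
  refine LinearMap.ext fun φ => fin₀_induction (p := fun φ => S φ = T φ) h ?_ ?_ ?_ φ
  · simp
  · intro φ ψ h1 h2
    rw [map_add, map_add, h1, h2]
  · intro c φ h1
    rw [map_smul, map_smul, h1]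

end Span

section Basis

variable {H : Type*} [NormedAddCommGroup H] [Module HOp H] [RightInner H] {e : ℕ → H}

theorem ip_vec (he : IsHilbertBasis e) (m n : ℕ) :
    ip (vec e m : H) (vec e n : H) = if m = n then 1 else 0 :=
  he.orthonormal m n

theorem norm_vec (he : IsHilbertBasis e) (n : ℕ) : ‖(vec e n : H)‖ = 1 := by
  have := ip_vec he n n
  rw [if_pos rfl, ip_self, ← Quaternion.coe_one, Quaternion.coe_inj] at this
  exact (sq_eq_sq₀ (norm_nonneg _) zero_le_one).1 (by rw [this, one_pow])

variable (he : IsHilbertBasis e)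

theorem ketBra_vec (s : ℕ → ℕ) (w : ℕ → Quaternion ℝ) (t : ℕ → ℕ) (ht : Function.Injective t)
    (n : ℕ) : ketBra he s w t ht (vec e (t n)) = op (w n) • vec e (s n) := by
  change ∑ᶠ k : ℕ, op (w k * ip (e (t k)) (e (t n))) • vec e (s k) = _
  rw [finsum_eq_single _ n fun k hk => by simp [he.orthonormal, ht.ne hk]]
  simp [he.orthonormal]

@[simp]
theorem leftOp_vec (q : Quaternion ℝ) (n : ℕ) : leftOp he q (vec e n) = op q • vec e n :=
  ketBra_vec he id _ id _ n

@[simp]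
theorem creat_vec (n : ℕ) :
    creat he (vec e n) = op (((√((n : ℝ) + 1) : ℝ) : Quaternion ℝ)) • vec e (n + 1) :=
  ketBra_vec he Nat.succ _ id _ n

-- The truncated index `0 - 1 = 0` is harmless, since its coefficient is `√0 = 0`.
@[simp]
theorem annih_vec (n : ℕ) :
    annih he (vec e n) = op (((√(n : ℝ) : ℝ) : Quaternion ℝ)) • vec e (n - 1) := by
  cases n with
  | zero =>
    change ∑ᶠ k : ℕ, op (_ * ip (e (k + 1)) (e 0)) • vec e k = _
    simp [he.orthonormal]
  | succ n =>
    refine (ketBra_vec he id _ Nat.succ Nat.succ_injective n).trans ?_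
    simp

theorem ip_map_of_vec {S T : Module.End HOp (Fin₀ e)}
    (h : ∀ m n, ip (S (vec e m) : H) (vec e n : H) = ip (vec e m : H) (T (vec e n) : H))
    (φ ψ : Fin₀ e) : ip (S φ : H) (ψ : H) = ip (φ : H) (T ψ : H) := by
  refine fin₀_induction (p := fun φ => ip (S φ : H) (ψ : H) = ip (φ : H) (T ψ : H))
    (fun m => ?_) (by simp) (fun φ φ' h1 h2 => ?_) (fun c φ h1 => ?_) φ
  · refine fin₀_induction
      (p := fun ψ => ip (S (vec e m) : H) (ψ : H) = ip (vec e m : H) (T ψ : H))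
      (h m) (by simp) (fun φ φ' h1 h2 => ?_) (fun c φ h1 => ?_) ψ
    · simp only [map_add, Submodule.coe_add, ip_add_right, h1, h2]
    · simp only [map_smul, Submodule.coe_smul, ip_smul_right, h1]
  · simp only [map_add, Submodule.coe_add, ip_add_left, h1, h2]
  · simp only [map_smul, Submodule.coe_smul, ip_smul_left, h1]

theorem ip_leftOp (q : Quaternion ℝ) (φ ψ : Fin₀ e) :
    ip (leftOp he q φ : H) (ψ : H) = ip (φ : H) (leftOp he (star q) ψ : H) := by
  refine ip_map_of_vec (fun m n => ?_) φ ψ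
  rw [leftOp_vec, leftOp_vec, Submodule.coe_smul, Submodule.coe_smul, ip_smul_left, ip_smul_right,
    ip_vec he]
  split_ifs <;> simp

theorem ip_creat (φ ψ : Fin₀ e) : ip (creat he φ : H) (ψ : H) = ip (φ : H) (annih he ψ : H) := by
  refine ip_map_of_vec (fun m n => ?_) φ ψ
  rw [creat_vec, annih_vec, Submodule.coe_smul, Submodule.coe_smul, ip_smul_left, ip_smul_right,
    ip_vec he, ip_vec he]
  rcases n with _ | n
  · simp
  · by_cases h : m = n
    · simp [h]
    · simp [h]

theorem ip_annih (φ ψ : Fin₀ e) : ip (annih he φ : H) (ψ : H) = ip (φ : H) (creat he ψ : H) := by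
  rw [← star_ip, ← ip_creat, star_ip]

theorem leftOp_mul (p q : Quaternion ℝ) : leftOp he (p * q) = leftOp he p * leftOp he q :=
  end_ext fun n => by simp [smul_smul]

theorem leftOp_one : leftOp he 1 = 1 := end_ext fun n => by simp

theorem leftOp_pow (q : Quaternion ℝ) (n : ℕ) : leftOp he (q ^ n) = leftOp he q ^ n := by
  induction n with
  | zero => exact leftOp_one he
  | succ n ih => rw [pow_succ, pow_succ, leftOp_mul, ih]

theorem leftOp_add (p q : Quaternion ℝ) : leftOp he (p + q) = leftOp he p + leftOp he q :=
  end_ext fun n => by simp [add_smul]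

theorem leftOp_neg (q : Quaternion ℝ) : leftOp he (-q) = -leftOp he q :=
  end_ext fun n => by
    rw [LinearMap.neg_apply, leftOp_vec, leftOp_vec, op_neg]
    exact neg_smul (op q) (vec e n)

/-- The weights `√(n+1)` are real, hence central in the quaternions. -/
theorem commute_leftOp_creat (q : Quaternion ℝ) : Commute (leftOp he q) (creat he) :=
  end_ext fun n => by
    simp [smul_smul, ← op_mul, Quaternion.coe_commutes]

theorem commute_leftOp_annih (q : Quaternion ℝ) : Commute (leftOp he q) (annih he) :=
  end_ext fun n => by
    simp [smul_smul, ← op_mul, Quaternion.coe_commutes]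

theorem commute_leftOp_dispGen {x q : Quaternion ℝ} (h : x * q = q * x) :
    Commute (leftOp he x) (dispGen he q) := by
  -- The conjugate is `2 Re q - q`, so it commutes with whatever commutes with `q`.
  have h' : x * star q = star q * x := by
    rw [Quaternion.star_eq_two_re_sub, mul_sub, sub_mul, h, Quaternion.coe_commutes]
  have hl : ∀ {p : Quaternion ℝ}, x * p = p * x → Commute (leftOp he x) (leftOp he p) :=
    fun {p} hp => by rw [commute_iff_eq, ← leftOp_mul, hp, leftOp_mul]
  have h1 := ((hl h).mul_right (commute_leftOp_creat he x)).eq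
  have h2 := ((hl h').mul_right (commute_leftOp_annih he x)).eq
  refine LinearMap.ext fun φ => ?_
  have h1 := LinearMap.congr_fun h1 φ
  have h2 := LinearMap.congr_fun h2 φ
  simp only [Module.End.mul_apply] at h1 h2
  simp only [dispGen, Module.End.mul_apply, LinearMap.sub_apply, map_sub, h1, h2]

theorem dispGen_add (p q : Quaternion ℝ) :
    dispGen he (p + q) = dispGen he p + dispGen he q := by
  simp only [dispGen, leftOp_add, star_add, add_mul]
  abel

theorem dispGen_zero : dispGen he 0 = 0 := by
  refine LinearMap.ext fun φ => ?_
  have := LinearMap.congr_fun (dispGen_add he 0 0) φ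
  rwa [add_zero, LinearMap.add_apply, left_eq_add] at this

/-- The adjoint of `q · a†` is `q̄ · a` because left multiplications commute with `a`; thus `dispGen
he q` is an operator minus its adjoint. -/
theorem ip_weylHeisenberg {x q : Quaternion ℝ} (hx : x.re = 0) (φ ψ : Fin₀ e) :
    ip ((leftOp he x + dispGen he q) φ : H) (ψ : H) =
      -ip (φ : H) ((leftOp he x + dispGen he q) ψ : H) := by
  have hstar : star x = -x := Quaternion.star_eq_neg.2 hx
  have h1 : ∀ ψ, annih he (leftOp he (star q) ψ) = leftOp he (star q) (annih he ψ) := fun ψ =>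
    LinearMap.congr_fun (commute_leftOp_annih he (star q)).symm.eq ψ
  have h2 : ∀ ψ, creat he (leftOp he q ψ) = leftOp he q (creat he ψ) := fun ψ =>
    LinearMap.congr_fun (commute_leftOp_creat he q).symm.eq ψ
  simp only [dispGen, LinearMap.add_apply, LinearMap.sub_apply, Module.End.mul_apply,
    Submodule.coe_add, Submodule.coe_sub, ip_add_left, ip_sub_left, ip_add_right, ip_sub_right,
    ip_leftOp, ip_creat, ip_annih, star_star, h1, h2, hstar, leftOp_neg, LinearMap.neg_apply,
    Submodule.coe_neg, ip_neg_right]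
  abel

end Basis

/-! ### Growth estimates: finite combinations are entire vectors. -/

section EntireVectors

variable {H : Type*} [NormedAddCommGroup H] [Module HOp H] [RightInner H] {e : ℕ → H}
  (he : IsHilbertBasis e)

theorem weylHeisenberg_vec (x q : Quaternion ℝ) (m : ℕ) :
    (leftOp he x + dispGen he q) (vec e m) = op x • vec e m +
      (op (q * (√((m : ℝ) + 1) : ℝ)) • vec e (m + 1) -
        op (star q * (√(m : ℝ) : ℝ)) • vec e (m - 1)) := by
  simp only [dispGen, LinearMap.add_apply, LinearMap.sub_apply, Module.End.mul_apply, leftOp_vec,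
    creat_vec, annih_vec, map_smul, smul_smul, op_mul]

/-- The innermost factor is peeled off: it moves `m` by at most one with weights at most `√(m+1)`,
and the induction hypothesis is used at each neighbour. -/
theorem norm_pow_vec_le (x q : Quaternion ℝ) (n m : ℕ) :
    ‖(((leftOp he x + dispGen he q) ^ n) (vec e m) : H)‖ ≤
      (‖x‖ + 2 * ‖q‖) ^ n * √((m + 1).ascFactorial n : ℝ) := by
  induction n generalizing m with
  | zero => simp [norm_vec he, -coe_vec]
  | succ n ih =>
    set C := ‖x‖ + 2 * ‖q‖ with hC
    set B := √((m + 1).ascFactorial (n + 1) : ℝ) with hB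
    -- One bound for all three terms: `(k, j)` will be `(1, m)`, `(m+1, m+1)` and `(m, m-1)`.
    have hb : ∀ k j : ℕ, k ≤ m + 1 → j ≤ m + 1 →
        √(k : ℝ) * ‖(((leftOp he x + dispGen he q) ^ n) (vec e j) : H)‖ ≤ C ^ n * B := by
      intro k j hk hj
      have hasc : ((j + 1).ascFactorial n : ℝ) ≤ (m + 1 + 1).ascFactorial n :=
        Nat.cast_le.2 (Nat.ascFactorial_le n (by omega))
      calc _ ≤ √((m + 1 : ℕ) : ℝ) * (C ^ n * √((m + 1 + 1).ascFactorial n : ℝ)) :=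
            mul_le_mul (Real.sqrt_le_sqrt (Nat.cast_le.2 hk))
              ((ih j).trans (mul_le_mul_of_nonneg_left (Real.sqrt_le_sqrt hasc) (by positivity)))
              (norm_nonneg _) (Real.sqrt_nonneg _)
        _ = C ^ n * B := by
            rw [hB, Nat.ascFactorial_succ, ← Nat.succ_ascFactorial, Nat.cast_mul,
              Real.sqrt_mul (by positivity)]
            ring
    rw [pow_succ, Module.End.mul_apply, weylHeisenberg_vec, map_add, map_sub, map_smul, map_smul,
      map_smul, Submodule.coe_add, Submodule.coe_sub, Submodule.coe_smul, Submodule.coe_smul,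
      Submodule.coe_smul]
    refine (norm_add_le _ _).trans ((add_le_add_right (norm_sub_le _ _) _).trans ?_)
    simp only [norm_smul_hop, unop_op, norm_mul, norm_star, Quaternion.norm_coe, Real.norm_eq_abs,
      abs_of_nonneg (Real.sqrt_nonneg _)]
    have h1 := hb 1 m (by omega) (by omega)
    have h2 := hb (m + 1) (m + 1) le_rfl le_rfl
    have h3 := hb m (m - 1) (by omega) (by omega)
    rw [Nat.cast_one, Real.sqrt_one, one_mul] at h1
    push_cast at h2
    calc _ ≤ ‖x‖ * (C ^ n * B) + (‖q‖ * (C ^ n * B) + ‖q‖ * (C ^ n * B)) := by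
          rw [mul_assoc, mul_assoc]
          gcongr
      _ = C ^ (n + 1) * B := by rw [hC]; ring

/-- The rising factorial is `n!` times a binomial coefficient, hence at most `n! 2^(m+n)`. The
squared term is then at most `(4r²)ⁿ/n!` times `2^m (1/2)ⁿ`, and the arithmetic-geometric mean
inequality bounds the term by half the sum of these two summable terms. -/
theorem summable_pow_mul_sqrt_ascFactorial (r : ℝ) (m : ℕ) :
    Summable fun n : ℕ => r ^ n / n.factorial * √((m + 1).ascFactorial n : ℝ) := by
  have h1 : Summable fun n : ℕ => ((4 * r ^ 2) ^ n / n.factorial + 2 ^ m * (1 / 2) ^ n) / 2 :=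
    ((Real.summable_pow_div_factorial _).add
      ((summable_geometric_of_lt_one (by norm_num) (by norm_num)).mul_left _)).div_const _
  refine Summable.of_norm_bounded h1 fun n => ?_
  have hch : ((m + 1).ascFactorial n : ℝ) ≤ n.factorial * (2 ^ m * 2 ^ n) := by
    rw [Nat.ascFactorial_eq_factorial_mul_choose, ← pow_add]
    exact_mod_cast Nat.mul_le_mul_left _ (Nat.choose_le_two_pow _ _)
  rw [Real.norm_eq_abs]
  refine abs_le_of_sq_le_sq ?_ (by positivity)
  have hf : (0 : ℝ) < n.factorial := by positivity
  calc (r ^ n / n.factorial * √((m + 1).ascFactorial n : ℝ)) ^ 2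
      = (r ^ 2) ^ n / n.factorial ^ 2 * (m + 1).ascFactorial n := by
        rw [mul_pow, Real.sq_sqrt (by positivity), div_pow, ← pow_mul, ← pow_mul, mul_comm n]
    _ ≤ (r ^ 2) ^ n / n.factorial ^ 2 * (n.factorial * (2 ^ m * 2 ^ n)) := by gcongr
    _ = (4 * r ^ 2) ^ n / n.factorial * (2 ^ m * (1 / 2) ^ n) := by
        rw [mul_pow, show (4 : ℝ) = 2 * 2 by norm_num, mul_pow, one_div, inv_pow]
        field_simp
    _ ≤ _ := by
        nlinarith [sq_nonneg ((4 * r ^ 2) ^ n / (n.factorial : ℝ) - 2 ^ m * (1 / 2) ^ n)]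

theorem summable_norm_pow (x q : Quaternion ℝ) (t : ℝ) (φ : Fin₀ e) :
    Summable fun n : ℕ =>
      |t| ^ n / n.factorial * ‖(((leftOp he x + dispGen he q) ^ n) φ : H)‖ := by
  refine fin₀_induction (p := fun φ => Summable fun n : ℕ =>
      |t| ^ n / n.factorial * ‖(((leftOp he x + dispGen he q) ^ n) φ : H)‖) (fun m => ?_)
      (by simp) (fun φ ψ h1 h2 => ?_) (fun c φ h => ?_) φ
  · refine Summable.of_nonneg_of_le (fun n => by positivity) (fun n => ?_)
      (summable_pow_mul_sqrt_ascFactorial (|t| * (‖x‖ + 2 * ‖q‖)) m)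
    rw [mul_pow, mul_div_right_comm, mul_assoc]
    gcongr
    exact norm_pow_vec_le he x q n m
  · refine Summable.of_nonneg_of_le (fun n => by positivity) (fun n => ?_) (h1.add h2)
    rw [map_add, Submodule.coe_add, ← mul_add]
    gcongr
    exact norm_add_le _ _
  · simp only [map_smul, Submodule.coe_smul, norm_smul_hop, mul_left_comm _ ‖c.unop‖]
    exact h.mul_left _

end EntireVectors

/-! ### Normal form of the elements of the algebra. -/

section WeylHeisenberg

variable {H : Type*} [NormedAddCommGroup H] [Module HOp H] [RightInner H]
  [NormedSpace ℝ H] [IsScalarTower ℝ HOp H] {e : ℕ → H} (he : IsHilbertBasis e)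

theorem leftOp_smul (r : ℝ) (q : Quaternion ℝ) : leftOp he (r • q) = r • leftOp he q :=
  end_ext fun n => by
    rw [LinearMap.smul_apply, leftOp_vec, leftOp_vec, op_smul, smul_assoc]

theorem leftOp_coe (r : ℝ) (φ : Fin₀ e) : leftOp he (r : Quaternion ℝ) φ = r • φ := by
  rw [← mul_one (r : Quaternion ℝ), Quaternion.coe_mul_eq_smul, leftOp_smul, leftOp_one]
  rfl

theorem dispGen_smul (r : ℝ) (q : Quaternion ℝ) : dispGen he (r • q) = r • dispGen he q := by
  refine LinearMap.ext fun φ => ?_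
  simp only [dispGen, Quaternion.star_smul, leftOp_smul, LinearMap.smul_apply,
    LinearMap.sub_apply, Module.End.mul_apply, smul_sub]

/-- The elements of the Weyl–Heisenberg algebra are the operators `x · 𝕀 + (q · a† - q̄ · a)`
with `x` purely imaginary. -/
theorem exists_of_mem_weylHeisenberg {A : Module.End HOp (Fin₀ e)} (hA : A ∈ weylHeisenberg he) :
    ∃ x q : Quaternion ℝ, x.re = 0 ∧ A = leftOp he x + dispGen he q := by
  have h0 : leftOp he 0 = 0 := end_ext fun n => by simp
  have hre : ∀ τ, (imagUnit τ).re = 0 := fun τ => by fin_cases τ <;> rfl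
  induction hA using Submodule.span_induction with
  | mem A hA =>
    rcases hA with (⟨τ, rfl⟩ | ⟨τ, rfl⟩) | rfl
    · exact ⟨imagUnit τ, 0, hre τ, by rw [dispGen_zero, add_zero]⟩
    -- Since `τ̄ = -τ`, the operator `τ · a† - τ̄ · a` is `τ · (a† + a)`.
    · refine ⟨0, (1 / √2 : ℝ) • imagUnit τ, rfl, ?_⟩
      have hstar : star (imagUnit τ) = -imagUnit τ := Quaternion.star_eq_neg.2 (hre τ)
      refine LinearMap.ext fun φ => ?_
      simp only [h0, zero_add, dispGen_smul]
      simp only [dispGen, posOp, hstar, leftOp_neg, LinearMap.smul_apply, LinearMap.sub_apply,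
        LinearMap.add_apply, LinearMap.neg_apply, Module.End.mul_apply, map_add, smul_sub,
        LinearMap.map_smul_of_tower, smul_add, smul_neg]
      abel
    · refine ⟨0, (1 / √2 : ℝ) • 1, rfl, ?_⟩
      refine LinearMap.ext fun φ => ?_
      simp only [h0, zero_add, dispGen_smul]
      simp only [dispGen, momOp, star_one, leftOp_one, LinearMap.smul_apply, LinearMap.sub_apply,
        LinearMap.neg_apply, Module.End.mul_apply, Module.End.one_apply, smul_sub]
      abel
  | zero => exact ⟨0, 0, rfl, by rw [h0, dispGen_zero, add_zero]⟩
  | add A B _ _ hA hB =>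
    obtain ⟨x, q, hx, rfl⟩ := hA
    obtain ⟨y, p, hy, rfl⟩ := hB
    refine ⟨x + y, q + p, by rw [Quaternion.re_add, hx, hy, add_zero], ?_⟩
    rw [leftOp_add, dispGen_add]
    abel
  | smul r A _ hA =>
    obtain ⟨x, q, hx, rfl⟩ := hA
    refine ⟨r • x, r • q, by rw [Quaternion.re_smul, hx, smul_zero], ?_⟩
    rw [leftOp_smul, dispGen_smul, smul_add]

end WeylHeisenberg

open Filter Topology

/-! ### From the real unitary group to right-linear operators and their exponentials. -/

section Unitary

variable {H : Type*} [NormedAddCommGroup H] [Module HOp H] [RightInner H]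

theorem isUnitary_of_re {U V : Module.End HOp H}
    (h : ∀ f g : H, (ip (U f) g).re = (ip f (V g)).re) (hUV : ∀ f, U (V f) = f)
    (hVU : ∀ f, V (U f) = f) : IsUnitary U :=
  ⟨V, ip_eq_of_re h, LinearMap.ext hUV, LinearMap.ext hVU⟩

theorem IsUnitary.mul {U V : Module.End HOp H} (hU : IsUnitary U) (hV : IsUnitary V) :
    IsUnitary (U * V) := by
  obtain ⟨U', h1, h2, h3⟩ := hU
  obtain ⟨V', h4, h5, h6⟩ := hV
  refine ⟨V' * U', fun φ ψ => ?_, ?_, ?_⟩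
  · rw [Module.End.mul_apply, Module.End.mul_apply, h1, h4]
  · rw [mul_assoc, ← mul_assoc V, h5, one_mul, h2]
  · rw [mul_assoc, ← mul_assoc U', h3, one_mul, h6]

/-- The partial sums of the expansion of a vector in the basis `e`. -/
def proj (e : ℕ → H) (s : Finset ℕ) : H →+ H :=
  AddMonoidHom.mk' (fun f => ∑ k ∈ s, op (ip (e k) f) • e k) fun f g => by
    simp only [ip_add_right, op_add, add_smul, Finset.sum_add_distrib]

theorem proj_apply (e : ℕ → H) (s : Finset ℕ) (f : H) :
    proj e s f = ∑ k ∈ s, op (ip (e k) f) • e k := rfl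

end Unitary

section Inclusion

variable {H : Type*} [NormedAddCommGroup H] [Module HOp H]
  [NormedSpace ℝ H] [IsScalarTower ℝ HOp H] {e : ℕ → H}

/-- The inclusion of the domain, as a real linear map. -/
def incl (e : ℕ → H) : Fin₀ e →ₗ[ℝ] H := (Fin₀ e).subtype.restrictScalars ℝ

@[simp]
theorem incl_apply (φ : Fin₀ e) : incl e φ = φ := rfl

theorem restrictScalars_pow (A : Module.End HOp (Fin₀ e)) (n : ℕ) (φ : Fin₀ e) :
    ((A.restrictScalars ℝ : Module.End ℝ (Fin₀ e)) ^ n) φ = (A ^ n) φ := by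
  induction n generalizing φ with
  | zero => rfl
  | succ n ih => rw [pow_succ, pow_succ, Module.End.mul_apply, Module.End.mul_apply, ih]; rfl

end Inclusion

section Extension

variable {H : Type*} [NormedAddCommGroup H] [Module HOp H] [RightInner H]
  [NormedSpace ℝ H] [IsScalarTower ℝ HOp H] {e : ℕ → H}

theorem denseRange_incl (he : IsHilbertBasis e) : DenseRange (incl e) := by
  have h : Set.range (incl e) = (Fin₀ e : Set H) := Subtype.range_coe
  rw [DenseRange, h]
  exact he.dense_span

theorem eq_of_eq_on_fin₀ (he : IsHilbertBasis e) {S T : H → H} (hS : Continuous S)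
    (hT : Continuous T) (h : ∀ φ : Fin₀ e, S φ = T φ) (f : H) : S f = T f :=
  congr_fun ((denseRange_incl he).equalizer hS hT (funext h)) f

/-- A bounded real linear operator that is right-linear on the finite combinations of the basis
vectors is right-linear. -/
def toEnd (he : IsHilbertBasis e) (U : H →L[ℝ] H)
    (hU : ∀ (c : HOp) (φ : Fin₀ e), U (c • (φ : H)) = c • U φ) : Module.End HOp H where
  toFun := U
  map_add' := map_add U
  map_smul' c f := eq_of_eq_on_fin₀ he (U.continuous.comp (continuous_smul_hop c))
    ((continuous_smul_hop c).comp U.continuous) (hU c) f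

/-- The series then has the graph of `U` restricted to a dense subspace, whose closure is the graph
of the continuous `U`. -/
theorem isExp_of_hasSum (he : IsHilbertBasis e) {A : Module.End HOp (Fin₀ e)}
    {U : Module.End HOp H} (hc : Continuous U)
    (hs : ∀ φ : Fin₀ e,
      HasSum (fun n : ℕ => ((n.factorial : ℝ)⁻¹) • (((A ^ n) φ : Fin₀ e) : H)) (U φ)) :
    IsExp A U := by
  have hset : {p : H × H | ∃ φ : Fin₀ e, (φ : H) = p.1 ∧
      HasSum (fun n : ℕ => ((n.factorial : ℝ)⁻¹) • (((A ^ n) φ : Fin₀ e) : H)) p.2} =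
      Set.range fun φ : Fin₀ e => ((φ : H), U φ) := by
    ext ⟨f, g⟩
    constructor
    · rintro ⟨φ, rfl, h⟩
      exact ⟨φ, Prod.ext rfl ((hs φ).unique h)⟩
    · rintro ⟨φ, h⟩
      obtain ⟨rfl, rfl⟩ := Prod.ext_iff.1 h
      exact ⟨φ, rfl, hs φ⟩
  rw [IsExp, hset]
  apply Set.Subset.antisymm
  · rintro ⟨f, g⟩ hfg
    obtain rfl : U f = g := hfg
    refine (denseRange_incl he).induction_on
      (p := fun f => (f, U f) ∈ closure (Set.range fun φ : Fin₀ e => ((φ : H), U φ))) f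
      (isClosed_closure.preimage (continuous_id.prodMk hc)) fun φ => subset_closure ⟨φ, rfl⟩
  · refine closure_minimal ?_ (isClosed_eq (hc.comp continuous_fst) continuous_snd)
    rintro _ ⟨φ, rfl⟩
    rfl

variable [CompleteSpace H]

/-- The operators `x · 𝕀 + (q · a† - q̄ · a)` with `x` imaginary generate unitary groups, given on
the finite combinations of the basis vectors by the exponential series. -/
theorem exists_unitary_group (he : IsHilbertBasis e) {x q : Quaternion ℝ} (hx : x.re = 0) :
    ∃ U : ℝ → Module.End HOp H, (∀ t, Continuous (U t)) ∧ (∀ t, IsUnitary (U t)) ∧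
      (∀ t (φ : Fin₀ e), HasSum (fun n : ℕ => (t ^ n / n.factorial : ℝ) •
        (((leftOp he x + dispGen he q) ^ n) φ : H)) (U t φ)) ∧
      IsGroupGeneratedBy (leftOp he x + dispGen he q) U := by
  set A := leftOp he x + dispGen he q with hA
  let _ : InnerProductSpace ℝ H := realInnerProductSpace
  have h : IsEntireSkew (incl e) (A.restrictScalars ℝ : Module.End ℝ (Fin₀ e)) :=
    { dense := denseRange_incl he
      skew := fun φ ψ => (congrArg QuaternionAlgebra.re (ip_weylHeisenberg he hx φ ψ)).trans
        (Quaternion.re_neg _)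
      entire := fun t φ => by
        simp only [restrictScalars_pow]
        exact summable_norm_pow he x q t φ }
  have hs : ∀ t (φ : Fin₀ e), HasSum (fun n : ℕ => (t ^ n / n.factorial : ℝ) •
      (((leftOp he x + dispGen he q) ^ n) φ : H)) (h.group t φ) := fun t φ => by
    have := h.hasSum_series t φ
    rw [← h.group_apply] at this
    simpa only [restrictScalars_pow, incl_apply] using this
  -- The real theory forgets right-linearity; it returns through the series, each term of which is
  -- right-linear.
  have hU : ∀ t (c : HOp) (φ : Fin₀ e), h.group t (c • (φ : H)) = c • h.group t φ := by
    intro t c φ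
    refine (hs t (c • φ)).unique ?_
    have := (hs t φ).map (DistribSMul.toAddMonoidHom H c) (continuous_smul_hop c)
    simpa only [Function.comp_def, map_smul, Submodule.coe_smul, DistribSMul.toAddMonoidHom_apply,
      smul_comm c] using this
  refine ⟨fun t => toEnd he (h.group t) (hU t), fun t => (h.group t).continuous, fun t => ?_, hs,
    ?_, ?_, ?_, ?_⟩
  · exact isUnitary_of_re (V := toEnd he (h.group (-t)) (hU (-t)))
      (fun f g => h.inner_group_left t f g) (h.group_group_neg t) (h.group_neg_group t)
  · exact LinearMap.ext h.group_zero
  · exact fun s t => LinearMap.ext (h.group_add s t)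
  · exact h.continuous_group
  · exact h.generator

end Extension

/-! ### Left multiplication on the whole space. -/

section LeftMultiplication

variable {H : Type*} [NormedAddCommGroup H] [Module HOp H] [RightInner H]
  [NormedSpace ℝ H] [IsScalarTower ℝ HOp H] {e : ℕ → H}

theorem norm_leftOp (he : IsHilbertBasis e) (q : Quaternion ℝ) (φ : Fin₀ e) :
    ‖(leftOp he q φ : H)‖ = ‖q‖ * ‖(φ : H)‖ := by
  have h : ip (leftOp he q φ : H) (leftOp he q φ : H) = ((‖q‖ * ‖(φ : H)‖) ^ 2 : ℝ) := by
    rw [ip_leftOp, ← Module.End.mul_apply, ← leftOp_mul, Quaternion.star_mul_self, leftOp_coe,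
      Submodule.coe_smul_of_tower, real_smul_eq, ip_smul_right, ip_self, unop_op,
      ← Quaternion.coe_mul, Quaternion.normSq_eq_norm_mul_self]
    congr 1
    ring
  rw [ip_self, Quaternion.coe_inj] at h
  exact (sq_eq_sq₀ (norm_nonneg _) (by positivity)).1 h

/-- Bessel's inequality: `⟨f | Pf⟩ = ⟨Pf | Pf⟩`, then Cauchy–Schwarz for the real part. -/
theorem norm_proj_le (he : IsHilbertBasis e) (s : Finset ℕ) (f : H) : ‖proj e s f‖ ≤ ‖f‖ := by
  let _ : InnerProductSpace ℝ H := realInnerProductSpace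
  have hk : ∀ k ∈ s, ip (e k) (proj e s f) = ip (e k) f := fun k hk => by
    rw [proj_apply, ip_sum_right, Finset.sum_eq_single k]
    · rw [ip_smul_right, he.orthonormal, if_pos rfl, one_mul, unop_op]
    · intro l _ hl
      rw [ip_smul_right, he.orthonormal, if_neg hl.symm, zero_mul]
    · exact fun h => absurd hk h
  have hp : ip f (proj e s f) = ip (proj e s f) (proj e s f) := by
    conv_lhs => rw [proj_apply]
    conv_rhs => rhs; rw [proj_apply]
    rw [ip_sum_right, ip_sum_right]
    refine Finset.sum_congr rfl fun k hk' => ?_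
    rw [ip_smul_right, ip_smul_right, ← star_ip _ f, ← star_ip _ (proj e s f), hk k hk']
  have h1 : ‖proj e s f‖ ^ 2 ≤ ‖f‖ * ‖proj e s f‖ := by
    rw [← real_inner_self_eq_norm_sq]
    exact (congrArg QuaternionAlgebra.re hp).symm.trans_le (real_inner_le_norm f _)
  rcases (norm_nonneg (proj e s f)).eq_or_lt with h0 | h0
  · exact h0 ▸ norm_nonneg f
  · exact le_of_mul_le_mul_right (by rwa [← sq]) h0

/-- The expansion is finite on a dense subspace, and the partial sums are uniformly bounded by
`norm_proj_le`. -/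
theorem hasSum_basis (he : IsHilbertBasis e) (f : H) :
    HasSum (fun k : ℕ => op (ip (e k) f) • e k) f := by
  have hfin : ∀ φ : Fin₀ e, HasSum (fun k : ℕ => op (ip (e k) (φ : H)) • e k) (φ : H) := by
    intro φ
    have h1 : Summable fun k : ℕ => op (1 * ip (e k) (φ : H)) • e k :=
      summable_of_hasFiniteSupport ((finite_support_ip he φ).subset fun k hk h0 =>
        hk (by simp only [h0, mul_zero, op_zero, zero_smul]))
    have h2 := h1.hasSum
    change HasSum _ (leftMul e 1 φ) at h2
    rw [← coe_leftOp he, leftOp_one] at h2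
    simpa only [one_mul, Module.End.one_apply] using h2
  refine Metric.tendsto_nhds.2 fun ε hε => ?_
  obtain ⟨φ, hφ⟩ := (denseRange_incl he).exists_dist_lt f (by positivity : 0 < ε / 3)
  rw [incl_apply] at hφ
  filter_upwards [Metric.tendsto_nhds.1 (hfin φ) (ε / 3) (by positivity)] with s hs
  change dist (proj e s φ) (φ : H) < ε / 3 at hs
  have h1 : dist (proj e s f) (proj e s φ) < ε / 3 := by
    rw [dist_eq_norm, ← map_sub]
    exact (norm_proj_le he s _).trans_lt (by rwa [← dist_eq_norm])
  calc dist (proj e s f) f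
      ≤ dist (proj e s f) (proj e s φ) + dist (proj e s φ) (φ : H) + dist (φ : H) f :=
        dist_triangle4 _ _ _ _
    _ < ε / 3 + ε / 3 + ε / 3 := by
        gcongr
        exact dist_comm f _ ▸ hφ
    _ = ε := by ring

variable [CompleteSpace H]

/-- The left multiplication by `q`, as an operator on the whole space. -/
def leftExt (he : IsHilbertBasis e) (q : Quaternion ℝ) : H →L[ℝ] H :=
  (incl e ∘ₗ (leftOp he q).restrictScalars ℝ).extendOfNorm (incl e)

theorem leftExt_apply (he : IsHilbertBasis e) (q : Quaternion ℝ) (φ : Fin₀ e) :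
    leftExt he q (φ : H) = leftOp he q φ :=
  LinearMap.extendOfNorm_eq (denseRange_incl he) ⟨‖q‖, fun φ => (norm_leftOp he q φ).le⟩ φ

/-- The left multiplication by `q`, as a right-linear operator on the whole space. -/
def leftEnd (he : IsHilbertBasis e) (q : Quaternion ℝ) : Module.End HOp H :=
  toEnd he (leftExt he q) fun c φ => by
    rw [leftExt_apply, ← Submodule.coe_smul, ← Submodule.coe_smul, leftExt_apply, map_smul]

theorem continuous_leftEnd (he : IsHilbertBasis e) (q : Quaternion ℝ) :
    Continuous (leftEnd he q) :=
  (leftExt he q).continuous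

theorem leftEnd_coe (he : IsHilbertBasis e) (q : Quaternion ℝ) (φ : Fin₀ e) :
    leftEnd he q (φ : H) = leftOp he q φ :=
  leftExt_apply he q φ

/-- The continuous right-linear extension is applied termwise to the basis expansion of `f`. -/
theorem leftEnd_eq_leftMul (he : IsHilbertBasis e) (q : Quaternion ℝ) (f : H) :
    leftEnd he q f = leftMul e q f := by
  have h := (hasSum_basis he f).map (leftEnd he q) (continuous_leftEnd he q)
  rw [leftMul, ← h.tsum_eq]
  refine tsum_congr fun k => ?_
  rw [Function.comp, map_smul, ← coe_vec (e := e), leftEnd_coe, leftOp_vec, Submodule.coe_smul, smul_smul,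
    op_mul]

theorem leftEnd_mul_apply (he : IsHilbertBasis e) (p q : Quaternion ℝ) (f : H) :
    leftEnd he (p * q) f = leftEnd he p (leftEnd he q f) :=
  eq_of_eq_on_fin₀ he (continuous_leftEnd he _)
    ((continuous_leftEnd he p).comp (continuous_leftEnd he q))
    (fun φ => by simp only [Function.comp, leftEnd_coe, leftOp_mul, Module.End.mul_apply]) f

theorem leftEnd_one_apply (he : IsHilbertBasis e) (f : H) : leftEnd he 1 f = f :=
  eq_of_eq_on_fin₀ he (continuous_leftEnd he _) continuous_id
    (fun φ => by rw [leftEnd_coe, leftOp_one]; rfl) f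

theorem isUnitary_leftEnd (he : IsHilbertBasis e) {q : Quaternion ℝ} (hq : ‖q‖ = 1) :
    IsUnitary (leftEnd he q) := by
  let _ : InnerProductSpace ℝ H := realInnerProductSpace
  have h1 : q * star q = 1 := by
    rw [Quaternion.self_mul_star, Quaternion.normSq_eq_norm_mul_self, hq, mul_one,
      Quaternion.coe_one]
  have h2 : star q * q = 1 := by
    rw [Quaternion.star_mul_self, Quaternion.normSq_eq_norm_mul_self, hq, mul_one,
      Quaternion.coe_one]
  refine isUnitary_of_re (V := leftEnd he (star q)) (fun f g => ?_) (fun f => ?_) (fun f => ?_)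
  · refine (denseRange_incl he).induction_on₂
      (p := fun f g => inner ℝ (leftEnd he q f) g = inner ℝ f (leftEnd he (star q) g))
      (isClosed_eq (((continuous_leftEnd he q).comp continuous_fst).inner continuous_snd)
        (continuous_fst.inner ((continuous_leftEnd he _).comp continuous_snd)))
      (fun φ ψ => ?_) f g
    rw [incl_apply, incl_apply, leftEnd_coe, leftEnd_coe]
    exact congrArg QuaternionAlgebra.re (ip_leftOp he q φ ψ)
  · rw [← leftEnd_mul_apply, h1, leftEnd_one_apply]
  · rw [← leftEnd_mul_apply, h2, leftEnd_one_apply]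

end LeftMultiplication

/-! ### Exponential of a sum of commuting operators. -/

section Exponential

variable {H : Type*} [NormedAddCommGroup H] [Module HOp H] [RightInner H]
  [NormedSpace ℝ H] [IsScalarTower ℝ HOp H] {e : ℕ → H}

theorem hasSum_leftOp (he : IsHilbertBasis e) (x : Quaternion ℝ) (φ : Fin₀ e) :
    HasSum (fun n : ℕ => ((n.factorial : ℝ)⁻¹) • ((leftOp he x ^ n) φ : H))
      (leftOp he (NormedSpace.exp x) φ : H) := by
  let T : Quaternion ℝ →+ H := AddMonoidHom.mk' (fun q => (leftOp he q φ : H)) fun p q => by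
    rw [leftOp_add, LinearMap.add_apply, Submodule.coe_add]
  have hT : Continuous T := AddMonoidHomClass.continuous_of_bound T ‖(φ : H)‖ fun q => by
    rw [mul_comm]
    exact (norm_leftOp he q φ).le
  have h := (NormedSpace.exp_series_hasSum_exp' (𝕂 := ℝ) x).map T hT
  change HasSum _ (T (NormedSpace.exp x))
  convert h using 1
  refine funext fun n => ?_
  change _ = (leftOp he (((n.factorial : ℝ)⁻¹) • x ^ n) φ : H)
  rw [leftOp_smul, leftOp_pow, LinearMap.smul_apply, Submodule.coe_smul_of_tower]

/-- The exponential series of a sum of commuting operators, one of which is a left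
multiplication. -/
theorem hasSum_pow_add [CompleteSpace H] (he : IsHilbertBasis e) {x : Quaternion ℝ}
    {B : Module.End HOp (Fin₀ e)}
    (hcomm : Commute (leftOp he x) B) {φ : Fin₀ e} {E : H →+ H} (hE : Continuous E)
    (hEx : ∀ ψ : Fin₀ e, E ψ = leftOp he (NormedSpace.exp x) ψ) {f : H}
    (hB : HasSum (fun n : ℕ => ((n.factorial : ℝ)⁻¹) • ((B ^ n) φ : H)) f)
    (hBs : Summable fun n : ℕ => ((n.factorial : ℝ)⁻¹) * ‖((B ^ n) φ : H)‖) :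
    HasSum (fun n : ℕ => ((n.factorial : ℝ)⁻¹) • (((leftOp he x + B) ^ n) φ : H)) (E f) := by
  -- The Cauchy product family: rows sum to `E (B^l φ / l!)`, antidiagonals to the terms of the
  -- exponential of the sum.
  let F : ℕ × ℕ → H := fun p =>
    ((p.1.factorial : ℝ)⁻¹ * (p.2.factorial : ℝ)⁻¹) • ((leftOp he x ^ p.2) ((B ^ p.1) φ) : H)
  have hF : Summable F := by
    refine Summable.of_norm ((hBs.mul_of_nonneg (Real.summable_pow_div_factorial ‖x‖)
      (fun n => by positivity) (fun n => by positivity)).congr fun p => ?_)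
    rw [norm_smul, ← leftOp_pow, norm_leftOp, norm_pow, Real.norm_of_nonneg (by positivity)]
    ring
  have hinner : ∀ l : ℕ, HasSum (fun k => F (l, k))
      (E (((l.factorial : ℝ)⁻¹) • ((B ^ l) φ : H))) := by
    intro l
    rw [← Submodule.coe_smul_of_tower, hEx, LinearMap.map_smul_of_tower,
      Submodule.coe_smul_of_tower]
    simpa only [F, mul_smul] using (hasSum_leftOp he x ((B ^ l) φ)).const_smul ((l.factorial : ℝ)⁻¹)
  have hval : HasSum F (E f) := by
    -- Absolute summability gives some sum; summing by rows identifies it as `E f`, by continuity of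
    -- `E`.
    have h1 := hF.hasSum.prod_fiberwise hinner
    rw [← h1.unique (hB.map E hE)]
    exact hF.hasSum
  have hanti := (Finset.HasAntidiagonal.sigmaAntidiagonalEquivProd.hasSum_iff.2 hval).sigma
    fun n => hasSum_fintype _
  convert hanti using 1
  refine funext fun n => ?_
  rw [add_comm, hcomm.symm.add_pow', ← Submodule.coe_smul_of_tower, LinearMap.sum_apply,
    Finset.smul_sum, Submodule.coe_sum]
  refine (Finset.sum_coe_sort (Finset.HasAntidiagonal.antidiagonal n) _).symm.trans ?_
  refine Finset.sum_congr rfl fun m _ => ?_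
  obtain ⟨m, hm⟩ := m
  rw [Finset.HasAntidiagonal.mem_antidiagonal] at hm
  change _ = F m
  rw [(hcomm.symm.pow_pow _ _).eq, LinearMap.smul_apply, Submodule.coe_smul_of_tower,
    Submodule.coe_smul_of_tower, ← Nat.cast_smul_eq_nsmul ℝ, smul_smul, Module.End.mul_apply]
  subst hm
  dsimp only
  rw [Nat.choose_symm_add, Nat.add_choose]
  congr 1
  rw [Nat.cast_div (Nat.factorial_mul_factorial_dvd_factorial_add _ _) (by positivity)]
  push_cast
  field_simp

end Exponential

end QFock

end

/-! ### The theorem. -/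

theorem mainTheorem3 {H : Type*} [NormedAddCommGroup H] [NormedSpace ℝ H] [Module QFock.HOp H]
    [IsScalarTower ℝ QFock.HOp H] [QFock.RightInner H] [CompleteSpace H]
    (e : ℕ → H) (he : QFock.IsHilbertBasis e)
    (A : Module.End QFock.HOp (QFock.Fin₀ e)) (hA : A ∈ QFock.weylHeisenberg he) :
    ∃ U : Module.End QFock.HOp H,
      QFock.IsExp A U ∧ QFock.IsUnitary U ∧ Continuous U ∧
      (∃ V : ℝ → Module.End QFock.HOp H,
        (∀ t : ℝ, QFock.IsExp (t • A) (V t)) ∧ QFock.IsGroupGeneratedBy A V) ∧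
      ∃ x q : Quaternion ℝ, x.re = 0 ∧ A = QFock.leftOp he x + QFock.dispGen he q ∧
        ∃ E D : Module.End QFock.HOp H,
          (∀ φ : H, E φ = QFock.leftMul e (NormedSpace.exp x) φ) ∧
          QFock.IsExp (QFock.dispGen he q) D ∧
          QFock.IsUnitary (E * D) ∧ Continuous (E * D) ∧
          (x * q = q * x → U = E * D) := by
  obtain ⟨x, q, hx, rfl⟩ := QFock.exists_of_mem_weylHeisenberg he hA
  obtain ⟨U, hUc, hUu, hUs, hUg⟩ := QFock.exists_unitary_group he (q := q) hx
  obtain ⟨D, hDc, hDu, hDs, -⟩ := QFock.exists_unitary_group he (x := 0) (q := q) rfl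
  have h0 : QFock.leftOp he 0 + QFock.dispGen he q = QFock.dispGen he q :=
    LinearMap.ext fun φ => by
      rw [LinearMap.add_apply, ← Quaternion.coe_zero, QFock.leftOp_coe, zero_smul, zero_add]
  rw [h0] at hDs
  -- The norm of a quaternionic exponential is that of the exponential of the real part, here `0`.
  have hexp : ‖NormedSpace.exp x‖ = 1 := by
    rw [Quaternion.norm_exp, hx, NormedSpace.exp_zero, norm_one]
  have hEc := QFock.continuous_leftEnd he (NormedSpace.exp x)
  have hU1 : ∀ φ : QFock.Fin₀ e, HasSum (fun n : ℕ => ((n.factorial : ℝ)⁻¹) •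
      (((QFock.leftOp he x + QFock.dispGen he q) ^ n) φ : H)) (U 1 φ) := fun φ => by
    simpa only [one_pow, one_div] using hUs 1 φ
  have hD1 : ∀ φ : QFock.Fin₀ e, HasSum (fun n : ℕ => ((n.factorial : ℝ)⁻¹) •
      ((QFock.dispGen he q ^ n) φ : H)) (D 1 φ) := fun φ => by
    simpa only [one_pow, one_div] using hDs 1 φ
  refine ⟨U 1, QFock.isExp_of_hasSum he (hUc 1) hU1, hUu 1, hUc 1, ⟨U, fun t => ?_, hUg⟩,
    x, q, hx, rfl, QFock.leftEnd he (NormedSpace.exp x), D 1, QFock.leftEnd_eq_leftMul he _,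
    QFock.isExp_of_hasSum he (hDc 1) hD1, (QFock.isUnitary_leftEnd he hexp).mul (hDu 1),
    hEc.comp (hDc 1), fun hxq => ?_⟩
  · refine QFock.isExp_of_hasSum he (hUc t) fun φ => ?_
    convert hUs t φ using 1
    refine funext fun n => ?_
    rw [smul_pow, LinearMap.smul_apply, Submodule.coe_smul_of_tower, smul_smul, div_eq_inv_mul]
  · refine LinearMap.ext (QFock.eq_of_eq_on_fin₀ he (hUc 1) (hEc.comp (hDc 1)) fun φ => ?_)
    -- On finite combinations both operators are sums of the same series; density does the rest.
    refine (hU1 φ).unique (QFock.hasSum_pow_add he (QFock.commute_leftOp_dispGen he hxq)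
      (E := (QFock.leftEnd he (NormedSpace.exp x)).toAddMonoidHom) hEc
      (QFock.leftEnd_coe he _) (hD1 φ) ?_)
    have := QFock.summable_norm_pow he 0 q 1 φ
    rw [h0] at this
    simpa only [abs_one, one_pow, one_div] using this
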